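/- **Setting.** A finite set $P$ of nodes is connected by a static, undirected interference graph without loops; $\mathcal N_i$ is the set of neighbors of $p_i$ and $d_i=|\mathcal N_i|$. The frame size is $T\ge 2$, every timeslot has $n=MaxRnd\ge 2$ listening/signaling periods, and $d_i<T$ for every $p_i\in P$. The timeslots $0,1,\dots,T-1,0,1,\dots$ are aligned by a common pulse. Every node $p_i$ holds a timeslot $s_i\in\{0,\dots,T-1\}\cup\{\bot\}$, a Boolean $signal_i$ and Booleans $unused_i[t]$, $0\le t<T$; let $unused\_set_i=\{t: unused_i[t]=\mathrm{true}\}$. **Algorithm.** At the pulse of timeslot $t$: if $t=0$ and $s_i=\bot$, then $s_i$ becomes a uniformly random element of $unused\_set_i$ (or $\bot$ if this set is empty); then $unused_i[t]:=\mathrm{true}$ and $signal_i:=\mathrm{false}$; and if $s_i=t$, then $p_i$ calls *send*. In *send*, $signal_i:=\mathrm{true}$; in each period $k=1,\dots,n$, if $signal_i$ still holds, then with probability $1/(n-k+1)$, independently of all other choices, $p_i$ sets $signal_i:=\mathrm{false}$ and transmits a beacon; after the $n$ periods, $p_i$ transmits its DATA packet if $s_i\ne\bot$. Every transmission in timeslot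 $t$ raises the event *carrier_sense*$(t)$ at all neighbors of the transmitter at the end of the period in which it takes place; there, if $s_j=t$ and $signal_j$ holds, then $s_j:=\bot$; after that $signal_j:=\mathrm{false}$ and $unused_j[t]:=\mathrm{false}$. An execution is an infinite sequence of configurations in which each one arises from the preceding one by a possible step of all nodes; a configuration may lie in the middle of a timeslot and includes the clock, the program counters and the transmissions under way. In the initial configuration all of these are arbitrary. A broadcasting round consists of the $T$ timeslots $0,\dots,T-1$. **Relative states.** At the start of a round consider, for node $p_i$: (1) $signal_i=\mathrm{false}$; (2) for every timeslot $t\ne s_i$: $t\in unused\_set_i$ if and only if $s_k\neq t$ for all $p_k\in\mathcal N_i$; (3) $s_i\ne\bot$ or $unused\_set_i\setminus\{s_i\}\neq\emptyset$; (4) $s_i\neq\bot$; (5) for all $p_j\in\mathcal N_i$: $s_i\ne s_j$ and $unused_j[s_i]=\mathrm{false}$. Node $p_i$ is *Ready* if (1)–(3) hold and (4) does not, *Obtaining* if (1)–(4) hold and (5) does not, and *Allocated* if (1)–(5) hold. **Task.** An execution is legal (for the task $\tau_{\mathrm{TDMA}}$) if in each of its configurations and for each $p_i$: if $s_i\neq\bot$,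 then $s_i\ne s_j$ for all $p_j\in\mathcal N_i$; and if $s_i=\bot$, then every timeslot equals $s_j$ for some $p_j\in\mathcal N_i$. A configuration is safe if some legal execution starts in it. **Theorem.** The algorithm is self-stabilizing with respect to $\tau_{\mathrm{TDMA}}$. In detail: *Convergence.* (a) In every execution, from an arbitrary initial configuration, there is a round start within the time of two broadcasting rounds such that at this round start and at every later one each node is Ready, Obtaining or Allocated. (b) There is $p>0$ such that from every configuration at a round start in which $p_i$ is Ready or Obtaining, $p_i$ is Allocated at the next round start with probability at least $p$. (c) From every initial configuration, almost surely the execution reaches, after finitely many steps, a round start at which all nodes are Allocated and whose configuration is safe; the expected number of steps until all nodes are Allocated at a round start is bounded uniformly in the initial configuration. *Closure.* (d) If all nodes are Allocated at a round start, then every execution from this configuration is legal, and all nodes are Allocated at every later round start. (e) Every execution that starts in a safe configuration at the beginning of a timeslot is legal. -/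

import Mathlib

open MeasureTheory ProbabilityTheory
open scoped ENNReal

namespace TDMA

/-! ## Configurations

`V` is the set of nodes, `T` the frame size and `n` the number `MaxRnd` of listening/signaling
periods of a timeslot.  The interference graph is a `SimpleGraph V`: the extended neighborhood of
`i` is the set of `j` with `G.Adj i j`. -/

/-- The instants of a timeslot at which the nodes take steps: the common pulse, the `n`
listening/signaling periods (beacons are sent in `signal k` and sensed in `listen k`), and the
`DATA` part (packets are sent in `data` and sensed in `receive`). -/
inductive Phase (n : ℕ) : Type
  | pulse
  | signal (k : Fin n)
  | listen (k : Fin n)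
  | data
  | receive
  deriving DecidableEq

/-- The local state of a node. -/
structure NodeState (T : ℕ) : Type where
  /-- the broadcasting timeslot; `none` is the null value `⊥` -/
  s : Option (Fin T)
  /-- is the node still competing in the current timeslot? -/
  signal : Bool
  /-- which timeslots are marked as unused -/
  unused : Fin T → Bool
  /-- program counter: is the node executing the function `send`? -/
  sending : Bool
  /-- in transit: a neighbor is transmitting, and `carrier_sense` has not been handled yet -/
  heard : Bool

/-- The set of timeslots that are marked as unused. -/
def NodeState.unusedSet {T : ℕ} (σ : NodeState T) : Finset (Fin T) :=
  Finset.univ.filter fun t => σ.unused t = true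

/-- A configuration: the common clock value, the position within the timeslot, and the states of
all nodes.  (The interference graph is static and is a parameter of the dynamics.) -/
structure Config (V : Type) (T n : ℕ) : Type where
  clock : Fin T
  phase : Phase n
  st : V → NodeState T

instance (V : Type) (T n : ℕ) : MeasurableSpace (Config V T n) := ⊤

/-! ## The program of a node -/

/-- `select_unused`: `⊥` for the empty set, otherwise a uniformly random element. -/
noncomputable def selectUnused {T : ℕ} (A : Finset (Fin T)) : PMF (Option (Fin T)) :=
  if h : A.Nonempty then (PMF.uniformOfFinset A h).map some else PMF.pure none

/-- First line of the `timeslot(t)` handler: `if t = 0 ∧ s = ⊥ then s := select_unused()`; this is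
the law of the resulting value of `s`. -/
noncomputable def NodeState.slotChoice {T : ℕ} (t : Fin T) (σ : NodeState T) :
    PMF (Option (Fin T)) :=
  if t.val = 0 ∧ σ.s = none then selectUnused σ.unusedSet else PMF.pure σ.s

/-- The `timeslot(t)` handler, `s'` being the outcome of its first line: `unused[t] := true`,
`signal := false`, and, if `t = s'`, the call of `send`, which starts by `signal := true`.
No transmission is under way at the pulse. -/
def NodeState.onTimeslot {T : ℕ} (t : Fin T) (s' : Option (Fin T)) (σ : NodeState T) :
    NodeState T where
  s := s'
  signal := decide (s' = some t)
  unused := Function.update σ.unused t true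
  sending := decide (s' = some t)
  heard := false

/-- A biased coin. -/
noncomputable def coin (p : ℝ≥0∞) (hp : p ≤ 1) : PMF Bool :=
  PMF.ofFintype (fun b => cond b p (1 - p)) (by simp [hp])

/-- `1 / (n - k)` is a probability for `k < n`. -/
theorem inv_sub_le_one {n : ℕ} (k : Fin n) : ((n - k.val : ℕ) : ℝ≥0∞)⁻¹ ≤ 1 := by
  rw [ENNReal.inv_le_one]
  exact_mod_cast Nat.sub_pos_of_lt k.isLt

/-- The decision whether to send a beacon in the listening/signaling period `k = 0, …, n - 1`:
a node that executes `send` and still competes does so with probability `1 / (n - k)`. -/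
noncomputable def NodeState.beaconChoice {T n : ℕ} (k : Fin n) (σ : NodeState T) : PMF Bool :=
  if σ.sending = true ∧ σ.signal = true then
    coin ((n - k.val : ℕ) : ℝ≥0∞)⁻¹ (inv_sub_le_one k)
  else PMF.pure false

/-- A node that sends its beacon (`b = true`) quits the competition. -/
def NodeState.onBeacon {T : ℕ} (b : Bool) (σ : NodeState T) : NodeState T :=
  { σ with signal := σ.signal && !b }

/-- The last line of `send`: the `DATA` packet is transmitted if `s ≠ ⊥`. -/
def NodeState.sendsData {T : ℕ} (σ : NodeState T) : Bool := σ.sending && σ.s.isSome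

/-- The node returns from `send`. -/
def NodeState.onData {T : ℕ} (σ : NodeState T) : NodeState T :=
  { σ with sending := false }

/-- The `carrier_sense(t)` handler: `if s = t ∧ signal then s := ⊥`, followed by
`signal := false` and `unused[t] := false`. -/
def NodeState.onCarrierSense {T : ℕ} (t : Fin T) (σ : NodeState T) : NodeState T :=
  { σ with
    s := if σ.s = some t ∧ σ.signal = true then none else σ.s
    signal := false
    unused := Function.update σ.unused t false }

/-- Handling of the pending `carrier_sense(t)` event, if there is one. -/
def NodeState.onListen {T : ℕ} (t : Fin T) (σ : NodeState T) : NodeState T :=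
  { (if σ.heard = true then σ.onCarrierSense t else σ) with heard := false }

/-! ## The steps of the system -/

/-- The clock advances modulo the frame size. -/
def nextClock {T : ℕ} (t : Fin T) : Fin T :=
  ⟨(t.val + 1) % T, Nat.mod_lt _ (Nat.lt_of_le_of_lt (Nat.zero_le _) t.isLt)⟩

/-- The phase after the `k`-th listening/signaling period (`k = 0` for the pulse). -/
def phaseAfter (n k : ℕ) : Phase n :=
  if h : k < n then .signal ⟨k, h⟩ else .data

/-- The law of a family of independent choices, one for each node. -/
noncomputable def independent {V α : Type} [Fintype V] [DecidableEq V] [Fintype α]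
    (p : V → PMF α) : PMF (V → α) :=
  PMF.ofFintype (fun f => ∏ v, p v (f v)) (by
    rw [← Fintype.prod_sum]
    refine Finset.prod_eq_one fun v _ => ?_
    rw [← tsum_fintype (L := .unconditional α)]
    exact (p v).tsum_coe)

section Dynamics

variable {V : Type} [Fintype V] [DecidableEq V] {T n : ℕ}
variable (G : SimpleGraph V) [DecidableRel G.Adj]

/-- Delivery of transmissions: `carrier_sense` is raised at every neighbor of a transmitter. -/
def deliver (tx : V → Bool) (st : V → NodeState T) : V → NodeState T :=
  fun v => { st v with heard := decide (∃ w, G.Adj v w ∧ tx w = true) }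

/-- The law of the next configuration; all nodes take a step, with independent random choices. -/
noncomputable def step (c : Config V T n) : PMF (Config V T n) :=
  match c.phase with
  | .pulse =>
      (independent fun v => (c.st v).slotChoice c.clock).map fun ch =>
        { clock := c.clock
          phase := phaseAfter n 0
          st := fun v => (c.st v).onTimeslot c.clock (ch v) }
  | .signal k =>
      (independent fun v => (c.st v).beaconChoice k).map fun b =>
        { clock := c.clock
          phase := .listen k
          st := deliver G b fun v => (c.st v).onBeacon (b v) }
  | .listen k => PMF.pure
        { clock := c.clock
          phase := phaseAfter n (k.val + 1)
          st := fun v => (c.st v).onListen c.clock }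
  | .data => PMF.pure
        { clock := c.clock
          phase := .receive
          st := deliver G (fun v => (c.st v).sendsData) fun v => (c.st v).onData }
  | .receive => PMF.pure
        { clock := nextClock c.clock
          phase := .pulse
          st := fun v => (c.st v).onListen c.clock }

/-- An execution: each configuration is obtained from the preceding one by a possible step. -/
def IsExecution (R : ℕ → Config V T n) : Prop :=
  ∀ m, R (m + 1) ∈ (step G (R m)).support

/-- The transition kernel, as a function of the history up to time `m`. -/
noncomputable def stepKernel (m : ℕ) :
    Kernel ((i : Finset.Iic m) → (fun _ : ℕ => Config V T n) i) (Config V T n) :=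
  Kernel.comap ⟨fun c => (step G c).toMeasure, measurable_from_top⟩
    (fun h => h ⟨m, Finset.mem_Iic.2 le_rfl⟩) (measurable_pi_apply _)

instance (m : ℕ) : IsMarkovKernel (stepKernel (T := T) (n := n) G m) :=
  ⟨fun h => PMF.toMeasure.isProbabilityMeasure
    (step G (h ⟨m, Finset.mem_Iic.2 le_rfl⟩))⟩

/-- The law of the random execution that starts in the configuration `c`. -/
noncomputable def law (c : Config V T n) : Measure (ℕ → Config V T n) :=
  Kernel.traj (X := fun _ : ℕ => Config V T n) (stepKernel G) 0 (fun _ => c)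

end Dynamics

/-! ## Rounds -/

/-- The number of steps of a broadcasting round: `T` timeslots, each with the pulse, two steps for
each of the `n` listening/signaling periods, and two steps for the `DATA` packet. -/
def roundLength (T n : ℕ) : ℕ := T * (2 * n + 3)

/-- The configuration is at the beginning of a timeslot. -/
def AtPulse {V : Type} {T n : ℕ} (c : Config V T n) : Prop := c.phase = .pulse

/-- The configuration is at the beginning of a broadcasting round. -/
def AtRoundStart {V : Type} {T n : ℕ} (c : Config V T n) : Prop :=
  AtPulse c ∧ c.clock.val = 0

section Task

variable {V : Type} {T n : ℕ} (G : SimpleGraph V)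

/-! ## Relative states -/

/-- `signal_i = false`. -/
def NotSignaling (c : Config V T n) (i : V) : Prop := (c.st i).signal = false

/-- Every timeslot other than `s_i` is marked as unused by `i` iff no neighbor of `i` uses it. -/
def ViewCorrect (c : Config V T n) (i : V) : Prop :=
  ∀ t : Fin T, (c.st i).s ≠ some t →
    ((c.st i).unused t = true ↔ ∀ k, G.Adj i k → (c.st k).s ≠ some t)

/-- `s_i ≠ ⊥` or `unused_set_i \ {s_i} ≠ ∅`. -/
def HasOption (c : Config V T n) (i : V) : Prop :=
  (c.st i).s ≠ none ∨ ∃ t ∈ (c.st i).unusedSet, (c.st i).s ≠ some t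

/-- `s_i ≠ ⊥`. -/
def HasSlot (c : Config V T n) (i : V) : Prop := (c.st i).s ≠ none

/-- No neighbor of `i` uses `s_i` or marks it as unused. -/
def SlotRespected (c : Config V T n) (i : V) : Prop :=
  ∀ j, G.Adj i j → (c.st i).s ≠ (c.st j).s ∧
    ∀ t : Fin T, (c.st i).s = some t → (c.st j).unused t = false

/-- The relative state `Ready`. -/
def Ready (c : Config V T n) (i : V) : Prop :=
  NotSignaling c i ∧ ViewCorrect G c i ∧ HasOption c i ∧ ¬ HasSlot c i

/-- The relative state `Obtaining`. -/
def Obtaining (c : Config V T n) (i : V) : Prop :=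
  NotSignaling c i ∧ ViewCorrect G c i ∧ HasOption c i ∧ HasSlot c i ∧ ¬ SlotRespected G c i

/-- The relative state `Allocated`. -/
def Allocated (c : Config V T n) (i : V) : Prop :=
  NotSignaling c i ∧ ViewCorrect G c i ∧ HasOption c i ∧ HasSlot c i ∧ SlotRespected G c i

/-- A broadcasting round starts, and all nodes are `Allocated`. -/
def AllAllocated (c : Config V T n) : Prop := AtRoundStart c ∧ ∀ i, Allocated G c i

/-- The number of steps until all nodes are `Allocated` at the start of a broadcasting round
(`∞` if this never happens). -/
noncomputable def convergenceTime (R : ℕ → Config V T n) : ℝ≥0∞ :=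
  ⨅ (m : ℕ) (_ : AllAllocated G (R m)), (m : ℝ≥0∞)

/-! ## The task -/

/-- The requirement of the task on a single configuration: a timeslot in use is unique within the
neighborhood, and a node may be without timeslot only if its neighbors use all of them. -/
def Legal (c : Config V T n) : Prop :=
  ∀ i, ((c.st i).s ≠ none → ∀ j, G.Adj i j → (c.st i).s ≠ (c.st j).s) ∧
    ((c.st i).s = none → ∀ t : Fin T, ∃ j, G.Adj i j ∧ (c.st j).s = some t)

variable [Fintype V] [DecidableEq V] [DecidableRel G.Adj]

/-- The set of legal executions. -/
def LE : Set (ℕ → Config V T n) := {R | IsExecution G R ∧ ∀ m, Legal G (R m)}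

/-- A configuration is safe if some legal execution starts in it. -/
def Safe (c : Config V T n) : Prop := ∃ R ∈ LE G, R 0 = c

end Task

end TDMA

namespace TDMA

/-! Correct views are deterministic. The pulse of slot `t` resets the mark of `t`. A transmitter has
already stopped competing, so it keeps its slot, and every mark "used" is backed by a neighbor that
uses `t`. Conversely every user of `t` still present in the DATA part transmits and is heard
(`LocalInv.step`, `step_receive`). Marks then stay correct until the next selection of slots, so
every round start preceded by a full round is `Consistent`. There the degree bound leaves each node
a free slot, which gives the three relative states.

Exclusive use of a slot (`Holds`) is the conserved quantity. Only a neighbor using the slot can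
evict its holder, and a neighbor can enter the slot only by selecting it at a round start, which
correct views forbid (`Holds.step`). At a consistent round start `Holds` gives `Allocated`. For
closure no views are needed: once every node has a slot, nobody selects.

For progress, a node with an option can be the only one to send a beacon in the first period of its
slot, since `n ≥ 2` allows all others silence; its rivals then drop out (`exists_reach_holds`).
Repeating this node by node reaches `AllAllocated` from every configuration. As there are finitely
many configurations, reachability alone yields a uniform positive probability and a geometric tail
for the hitting time (`exists_tsum_law_avoid_le`). -/

instance (n : ℕ) : Finite (Phase n) :=
  Finite.of_injective (β := Option (Option (Option (Fin n ⊕ Fin n))))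
    (fun
      | .pulse => none
      | .data => some none
      | .receive => some (some none)
      | .signal k => some (some (some (.inl k)))
      | .listen k => some (some (some (.inr k))))
    (by rintro (_ | _ | _ | _ | _) (_ | _ | _ | _ | _) h <;> simp_all)

instance (T : ℕ) : Finite (NodeState T) :=
  Finite.of_injective (fun σ => (σ.s, σ.signal, σ.unused, σ.sending, σ.heard))
    (by rintro ⟨⟩ ⟨⟩ h; simp_all)

instance (V : Type) [Finite V] (T n : ℕ) : Finite (Config V T n) :=
  Finite.of_injective (fun c => (c.clock, c.phase, c.st)) (by rintro ⟨⟩ ⟨⟩ h; simp_all)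

instance (V : Type) (T n : ℕ) : DiscreteMeasurableSpace (Config V T n) := ⟨fun _ => trivial⟩

/-! ### Events on trajectories: avoiding a set of configurations -/

section Trajectories

variable {V : Type} {T n : ℕ}

theorem measurableSet_eval_mem (A : Set (Config V T n)) (m : ℕ) :
    MeasurableSet {R : ℕ → Config V T n | R m ∈ A} :=
  (measurable_pi_apply m) (MeasurableSet.of_discrete (s := A))

/-- The executions that avoid `A` up to time `m`. -/
def avoid (A : Set (Config V T n)) (m : ℕ) : Set (ℕ → Config V T n) := {R | ∀ k ≤ m, R k ∉ A}

theorem measurableSet_avoid (A : Set (Config V T n)) (m : ℕ) : MeasurableSet (avoid A m) := by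
  have : avoid A m = ⋂ k, ⋂ (_ : k ≤ m), {R : ℕ → Config V T n | R k ∈ Aᶜ} := by
    ext R; simp [avoid]
  rw [this]
  exact .iInter fun k => .iInter fun _ => measurableSet_eval_mem _ k

/-- A hitting time counts the times `m` up to which the target is avoided. If it is never hit, every
summand is 1 and the sum is infinite. -/
theorem convergenceTime_le_tsum (G : SimpleGraph V) (R : ℕ → Config V T n) :
    convergenceTime G R ≤ ∑' m, (avoid {c | AllAllocated G c} m).indicator 1 R := by
  by_cases h : ∃ m, AllAllocated G (R m)
  · classical
    refine (iInf₂_le (Nat.find h) (Nat.find_spec h)).trans ?_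
    calc ((Nat.find h : ℕ) : ℝ≥0∞)
        = ∑ m ∈ Finset.range (Nat.find h), (avoid {c | AllAllocated G c} m).indicator 1 R := by
          rw [Finset.sum_congr rfl (g := fun _ => (1 : ℝ≥0∞))]
          · simp
          · intro m hm
            have : R ∈ avoid {c | AllAllocated G c} m := fun k hk =>
              Nat.find_min h (hk.trans_lt (Finset.mem_range.1 hm))
            simp [this]
      _ ≤ _ := ENNReal.sum_le_tsum _
  · have : ∀ m, (avoid {c | AllAllocated G c} m).indicator 1 R = (1 : ℝ≥0∞) := fun m => by
      have : R ∈ avoid {c | AllAllocated G c} m := fun k _ hk => h ⟨k, hk⟩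
      simp [this]
    simp [this]

end Trajectories

/-! ### The Markov property and paths of positive probability -/

section Markov

variable {V : Type} [Fintype V] [DecidableEq V] {T n : ℕ}
variable (G : SimpleGraph V) [DecidableRel G.Adj]

instance (c : Config V T n) : IsProbabilityMeasure (law G c) := by
  unfold law; infer_instance

/-- The Markov property of the random execution at time `m`. -/
theorem setLIntegral_law_succ (c : Config V T n) (m : ℕ)
    {S : Set ((i : Finset.Iic m) → Config V T n)} (hS : MeasurableSet S)
    (f : Config V T n → ℝ≥0∞) :
    ∫⁻ R in Preorder.frestrictLe (π := fun _ => Config V T n) m ⁻¹' S, f (R (m + 1)) ∂law G c =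
      ∫⁻ R in Preorder.frestrictLe (π := fun _ => Config V T n) m ⁻¹' S,
        ∫⁻ x, f x ∂(step G (R m)).toMeasure ∂law G c := by
  have hf : Measurable f := measurable_of_finite f
  have hm : MeasurableSet (Preorder.frestrictLe (π := fun _ => Config V T n) m ⁻¹' S) :=
    Preorder.measurable_frestrictLe m hS
  -- The joint law of the history up to `m` and the next configuration is the history law composed
  -- with the kernel; the claim is this identity integrated against `S.indicator (f ·)`.
  have key := Kernel.partialTraj_compProd_eq_map_traj (X := fun _ : ℕ => Config V T n)
    (κ := stepKernel G) (Nat.zero_le m) (x₀ := fun _ => c)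
  have hF : Measurable fun p : ((i : Finset.Iic m) → Config V T n) × Config V T n =>
      S.indicator (fun _ => f p.2) p.1 := by
    have : (fun p : ((i : Finset.Iic m) → Config V T n) × Config V T n =>
      S.indicator (fun _ => f p.2) p.1) = (Prod.fst ⁻¹' S).indicator (fun p => f p.2) := by
      ext p
      by_cases h : p.1 ∈ S <;> simp [h]
    rw [this]
    exact (hf.comp measurable_snd).indicator (measurable_fst hS)
  have h1 := congrArg (fun μ => ∫⁻ p, S.indicator (fun _ => f p.2) p.1 ∂μ) key
  beta_reduce at h1
  rw [Measure.lintegral_compProd hF, lintegral_map hF (by fun_prop)] at h1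
  rw [← lintegral_indicator hm, ← lintegral_indicator hm]
  have e1 : ∀ R : ℕ → Config V T n,
      (Preorder.frestrictLe (π := fun _ => Config V T n) m ⁻¹' S).indicator
        (fun R => f (R (m + 1))) R = S.indicator (fun _ => f (R (m + 1)))
          (Preorder.frestrictLe (π := fun _ => Config V T n) m R) := fun R => by
    by_cases h : Preorder.frestrictLe (π := fun _ => Config V T n) m R ∈ S <;> simp [h]
  simp only [e1]
  refine h1.symm.trans ?_
  rw [← Kernel.traj_map_frestrictLe_apply, lintegral_map ?_ (Preorder.measurable_frestrictLe m)]
  · refine lintegral_congr fun R => ?_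
    by_cases h : Preorder.frestrictLe (π := fun _ => Config V T n) m R ∈ S
    · simp only [h, Set.mem_preimage, Set.indicator_of_mem]
      rfl
    · simp [h]
  · exact hF.lintegral_kernel_prod_right'

theorem ae_law_zero (c : Config V T n) : ∀ᵐ R ∂law G c, R 0 = c := by
  have h := Kernel.traj_map_frestrictLe_apply (X := fun _ : ℕ => Config V T n)
    (κ := stepKernel G) 0 0 (fun _ => c)
  rw [Kernel.partialTraj_self, Kernel.id_apply] at h
  have h2 : ∀ᵐ x ∂(Measure.dirac (fun _ : Finset.Iic 0 => c)),
      x ⟨0, Finset.mem_Iic.2 le_rfl⟩ = c := by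
    rw [ae_dirac_iff]
    exact measurable_pi_apply (X := fun _ : Finset.Iic 0 => Config V T n) _
      (MeasurableSet.of_discrete (s := {c}))
  rw [← h] at h2
  exact ae_of_ae_map (Preorder.measurable_frestrictLe 0).aemeasurable h2

/-- There is a path with `m` possible steps from `c` to `x`. -/
inductive Reach (c : Config V T n) : ℕ → Config V T n → Prop
  | refl : Reach c 0 c
  | tail {m : ℕ} {x y : Config V T n} : Reach c m x → y ∈ (step G x).support → Reach c (m + 1) y

variable {G}

theorem Reach.trans {c x y : Config V T n} {k l : ℕ} (h : Reach G c k x) (h' : Reach G x l y) :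
    Reach G c (k + l) y := by
  induction h' with
  | refl => exact h
  | tail _ hy ih => exact ih.tail hy

variable (G)

/-- By the Markov property on the event `R m = x`, each further step of the path multiplies the
lower bound by the positive number `step G x y`. -/
theorem law_pos_of_reach {c x : Config V T n} {m : ℕ} (h : Reach G c m x) :
    0 < law G c {R | R m = x} := by
  induction h with
  | refl =>
    have h0 : law G c {R | R 0 = c} = 1 :=
      (prob_compl_eq_zero_iff (measurableSet_eval_mem {c} 0)).1 (ae_law_zero G c)
    simp [h0]
  | @tail m x y _ hy ih =>
    have hy' : 0 < step G x y := pos_iff_ne_zero.2 ((PMF.mem_support_iff _ _).1 hy)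
    have key := setLIntegral_law_succ G c m (S := {h | h ⟨m, Finset.mem_Iic.2 le_rfl⟩ = x})
      (measurable_pi_apply (X := fun _ : Finset.Iic m => Config V T n) _
        (MeasurableSet.of_discrete (s := {x}))) (Set.indicator {y} 1)
    have hpre : Preorder.frestrictLe (π := fun _ => Config V T n) m ⁻¹'
        {h | h ⟨m, Finset.mem_Iic.2 le_rfl⟩ = x} = {R | R m = x} := rfl
    rw [hpre] at key
    have h2 : ∫⁻ R in {R : ℕ → Config V T n | R m = x},
        ∫⁻ z, Set.indicator {y} 1 z ∂(step G (R m)).toMeasure ∂law G c =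
        step G x y * law G c {R | R m = x} := by
      refine (setLIntegral_congr_fun (g := fun _ => step G x y)
        (measurableSet_eval_mem {x} m) ?_).trans (setLIntegral_const _ _)
      intro R hR
      have hR : R m = x := hR
      simp only [hR]
      rw [lintegral_indicator_one (MeasurableSet.of_discrete),
        PMF.toMeasure_apply_singleton _ _ MeasurableSet.of_discrete]
    rw [h2] at key
    calc 0 < step G x y * law G c {R | R m = x} := ENNReal.mul_pos hy'.ne' ih.ne'
      _ = _ := key.symm
      _ ≤ ∫⁻ R, Set.indicator {y} 1 (R (m + 1)) ∂law G c := setLIntegral_le_lintegral _ _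
      _ = ∫⁻ R, Set.indicator {R : ℕ → Config V T n | R (m + 1) = y} 1 R ∂law G c := rfl
      _ = _ := lintegral_indicator_one (measurableSet_eval_mem {y} (m + 1))

/-! ### Hitting times -/

/-- The probability that `A` is avoided for `j` steps. -/
noncomputable def avoidProb (A : Set (Config V T n)) : ℕ → Config V T n → ℝ≥0∞
  | 0 => Aᶜ.indicator 1
  | j + 1 => Aᶜ.indicator fun c => ∫⁻ x, avoidProb A j x ∂(step G c).toMeasure

theorem avoidProb_of_mem {A : Set (Config V T n)} {c : Config V T n} (hc : c ∈ A) (j : ℕ) :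
    avoidProb G A j c = 0 := by
  cases j <;> simp [avoidProb, hc]

/-- Restart at time `m`: `avoidProb` depends only on the current configuration, which later makes
avoidance over successive blocks multiply. The induction on `j` varies `m`, as one step is handed
over from the second phase to the first. -/
theorem law_avoid_add (A : Set (Config V T n)) (c : Config V T n) (m j : ℕ) :
    law G c (avoid A (m + j)) = ∫⁻ R in avoid A m, avoidProb G A j (R m) ∂law G c := by
  induction j generalizing m with
  | zero =>
    rw [setLIntegral_congr_fun (g := fun _ => 1) (measurableSet_avoid A m)]
    · simp
    · intro R hR
      have : R m ∉ A := hR m le_rfl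
      simp [avoidProb, this]
  | succ j ih =>
    have hpre : avoid A m = Preorder.frestrictLe (π := fun _ => Config V T n) m ⁻¹'
        {h | ∀ k, h k ∉ A} := by
      ext R
      simp [avoid]
    have hS : MeasurableSet {h : (i : Finset.Iic m) → Config V T n | ∀ k, h k ∉ A} := by
      simp only [Set.ofPred_forall]
      exact .iInter fun k => measurable_pi_apply (X := fun _ : Finset.Iic m => Config V T n) k
        (MeasurableSet.of_discrete (s := Aᶜ))
    have key := setLIntegral_law_succ G c m hS (avoidProb G A j)
    rw [← hpre] at key
    rw [show m + (j + 1) = m + 1 + j by ring, ih]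
    -- The integrand vanishes when `R (m + 1) ∈ A`, so the condition at time `m + 1` can be dropped
    -- from the domain.
    have e1 : ∫⁻ R in avoid A (m + 1), avoidProb G A j (R (m + 1)) ∂law G c =
        ∫⁻ R in avoid A m, avoidProb G A j (R (m + 1)) ∂law G c := by
      rw [← lintegral_indicator (measurableSet_avoid A _),
        ← lintegral_indicator (measurableSet_avoid A _)]
      refine lintegral_congr fun R => ?_
      by_cases hA : R (m + 1) ∈ A
      · simp [Set.indicator, avoidProb_of_mem G hA]
      · have : R ∈ avoid A (m + 1) ↔ R ∈ avoid A m := by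
          refine ⟨fun h k hk => h k (by lia), fun h k hk => ?_⟩
          rcases Nat.le_succ_iff.1 hk with h' | rfl
          · exact h k h'
          · exact hA
        by_cases h : R ∈ avoid A m <;> simp [h, this.2, this]
    rw [e1, key]
    refine setLIntegral_congr_fun (measurableSet_avoid A m) fun R hR => ?_
    have : R m ∉ A := hR m le_rfl
    simp [avoidProb, this]

theorem law_avoid (A : Set (Config V T n)) (c : Config V T n) (j : ℕ) :
    law G c (avoid A j) = avoidProb G A j c := by
  have h := law_avoid_add G A c 0 j
  rw [zero_add] at h
  rw [h, ← lintegral_indicator (measurableSet_avoid A _),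
    lintegral_congr_ae (g := fun _ => avoidProb G A j c)]
  · simp
  · filter_upwards [ae_law_zero G c] with R hR
    by_cases hA : c ∈ A
    · simp [Set.indicator, hR, avoidProb_of_mem G hA]
    · have : R ∈ avoid A 0 := fun k hk => by
        obtain rfl := Nat.le_zero.1 hk
        rwa [hR]
      simp [this, hR]

theorem law_avoid_lt_one {A : Set (Config V T n)} {c x : Config V T n} {k m : ℕ}
    (h : Reach G c k x) (hx : x ∈ A) (hk : k ≤ m) : law G c (avoid A m) < 1 := by
  refine lt_of_le_of_ne prob_le_one fun h1 => (law_pos_of_reach G h).ne' ?_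
  have h2 := (prob_compl_eq_zero_iff (measurableSet_avoid A m)).2 h1
  refine measure_mono_null (fun R hR => ?_) h2
  have hR : R k = x := hR
  exact fun h3 => h3 k hk (hR ▸ hx)

/-- Division with remainder by `K`: each power `r ^ a` occurs exactly `K` times in the sum. -/
theorem tsum_pow_div (r : ℝ≥0∞) (K : ℕ) [NeZero K] :
    ∑' m : ℕ, r ^ (m / K) = K * (1 - r)⁻¹ := by
  rw [← (Nat.divModEquiv K).symm.tsum_eq, ENNReal.tsum_prod']
  have : ∀ (a : ℕ) (b : Fin K), r ^ ((Nat.divModEquiv K).symm (a, b) / K) = r ^ a := by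
    intro a b
    congr 1
    have := congrArg Prod.fst ((Nat.divModEquiv K).apply_symm_apply (a, b))
    simpa [Nat.divModEquiv] using this
  simp only [this]
  simp [ENNReal.tsum_mul_left, ENNReal.tsum_geometric]

/-- If `A` can be reached from every configuration, then the expected hitting time of `A` is
bounded. -/
theorem exists_tsum_law_avoid_le {A : Set (Config V T n)}
    (hA : ∀ c : Config V T n, ∃ k, ∃ x ∈ A, Reach G c k x) :
    ∃ B : NNReal, ∀ c : Config V T n, ∑' m, law G c (avoid A m) ≤ B := by
  classical
  have := Fintype.ofFinite (Config V T n)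
  choose k x hx hk using hA
  -- By finiteness one block length `K` serves all starting points, and the worst probability `r` of
  -- avoiding `A` during a block is below 1. The summand 1 keeps `K` nonzero.
  set K := Finset.univ.sup k + 1 with hK
  have : NeZero K := ⟨by lia⟩
  have hkK : ∀ c, k c ≤ K := fun c => (Finset.le_sup (Finset.mem_univ c)).trans (by lia)
  set r := Finset.univ.sup fun c => law G c (avoid A K) with hr
  have hr1 : r < 1 := (Finset.sup_lt_iff (by simp)).2
    fun c _ => law_avoid_lt_one G (hk c) (hx c) (hkK c)
  have hle : ∀ c, law G c (avoid A K) ≤ r := fun c =>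
    Finset.le_sup (f := fun c => law G c (avoid A K)) (Finset.mem_univ c)
  have hpow : ∀ c j, law G c (avoid A (j * K)) ≤ r ^ j := by
    intro c j
    induction j with
    | zero => simpa using prob_le_one
    | succ j ih =>
      rw [add_one_mul, law_avoid_add]
      calc ∫⁻ R in avoid A (j * K), avoidProb G A K (R (j * K)) ∂law G c
          ≤ ∫⁻ R in avoid A (j * K), r ∂law G c :=
            lintegral_mono fun R => by rw [← law_avoid]; exact hle _
        _ = r * law G c (avoid A (j * K)) := by rw [setLIntegral_const]
        _ ≤ r ^ (j + 1) := by rw [pow_succ']; gcongr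
  have hfin : (K : ℝ≥0∞) * (1 - r)⁻¹ ≠ ∞ :=
    ENNReal.mul_ne_top (by simp) (by simpa [tsub_eq_zero_iff_le] using hr1)
  refine ⟨((K : ℝ≥0∞) * (1 - r)⁻¹).toNNReal, fun c => ?_⟩
  rw [ENNReal.coe_toNNReal hfin, ← tsum_pow_div]
  refine ENNReal.tsum_le_tsum fun m => (measure_mono fun R hR l hl => ?_).trans (hpow c (m / K))
  exact hR l (hl.trans (Nat.div_mul_le_self m K))

theorem exists_lintegral_convergenceTime_le
    (hA : ∀ c : Config V T n, ∃ k, ∃ x, AllAllocated G x ∧ Reach G c k x) :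
    ∃ B : NNReal, ∀ c : Config V T n, ∫⁻ R, convergenceTime G R ∂(law G c) ≤ B := by
  obtain ⟨B, hB⟩ := exists_tsum_law_avoid_le G (A := {c | AllAllocated G c}) hA
  refine ⟨B, fun c => le_trans ?_ (hB c)⟩
  calc _ ≤ ∫⁻ R, ∑' m, (avoid {c | AllAllocated G c} m).indicator 1 R ∂(law G c) :=
        lintegral_mono (convergenceTime_le_tsum G)
    _ = _ := by
      rw [lintegral_tsum fun m =>
        (measurable_one.indicator (measurableSet_avoid _ m)).aemeasurable]
      simp [measurableSet_avoid]

theorem ae_exists_allAllocated {B : NNReal} {c : Config V T n}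
    (hB : ∫⁻ R, convergenceTime G R ∂(law G c) ≤ B) :
    ∀ᵐ R ∂(law G c), ∃ m, AllAllocated G (R m) := by
  have hmeas : Measurable (convergenceTime G : (ℕ → Config V T n) → ℝ≥0∞) := by
    refine .iInf fun m => ?_
    have : (fun R : ℕ → Config V T n => ⨅ _ : AllAllocated G (R m), (m : ℝ≥0∞)) =
        (fun c : Config V T n => ⨅ _ : AllAllocated G c, (m : ℝ≥0∞)) ∘ fun R => R m := rfl
    rw [this]
    exact (measurable_of_finite _).comp (measurable_pi_apply m)
  filter_upwards [ae_lt_top hmeas (ne_top_of_le_ne_top ENNReal.coe_ne_top hB)] with R hR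
  obtain ⟨m, hm⟩ := iInf_lt_iff.1 hR
  obtain ⟨h, -⟩ := iInf_lt_iff.1 hm
  exact ⟨m, h⟩

end Markov

/-! ### Supports of the random choices -/

theorem mem_support_independent {V α : Type} [Fintype V] [DecidableEq V] [Fintype α]
    {p : V → PMF α} {f : V → α} :
    f ∈ (independent p).support ↔ ∀ v, f v ∈ (p v).support := by
  simp [independent, PMF.mem_support_iff, Finset.prod_eq_zero_iff]

theorem mem_support_slotChoice {T : ℕ} {t : Fin T} {σ : NodeState T} {a : Option (Fin T)} :
    a ∈ (σ.slotChoice t).support ↔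
      if t.val = 0 ∧ σ.s = none then
        (∃ u, σ.unused u = true ∧ a = some u) ∨ ((∀ u, σ.unused u = false) ∧ a = none)
      else a = σ.s := by
  unfold NodeState.slotChoice selectUnused
  split_ifs with h1 h2
  · have : ∃ u, σ.unused u = true := by
      obtain ⟨u, hu⟩ := h2
      exact ⟨u, by simpa [NodeState.unusedSet] using hu⟩
    have h3 : ¬ ∀ u, σ.unused u = false := by simpa using this
    simp only [h3, false_and, or_false]
    rw [PMF.support_map, PMF.support_uniformOfFinset]
    simp only [NodeState.unusedSet, Finset.coe_filter, Finset.mem_univ, true_and, Set.mem_image,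
      Set.mem_ofPred_eq, eq_comm (a := a)]
  · have : ∀ u, σ.unused u = false := by
      simpa [NodeState.unusedSet, Finset.filter_nonempty_iff] using h2
    simp [this]
  · simp

theorem mem_support_coin {p : ℝ≥0∞} {hp : p ≤ 1} {b : Bool} :
    b ∈ (coin p hp).support ↔ (b = true ∧ p ≠ 0) ∨ (b = false ∧ p ≠ 1) := by
  cases b
  · simp [coin, tsub_eq_zero_iff_le, hp.ge_iff_eq', eq_comm (a := (1 : ℝ≥0∞))]
  · simp [coin]

/-- The beacon probability of a competitor is never 0, and is 1 exactly in the last period: silence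
is possible in all periods but that one. -/
theorem mem_support_beaconChoice {T n : ℕ} {k : Fin n} {σ : NodeState T} {b : Bool} :
    b ∈ (σ.beaconChoice k).support ↔
      if σ.sending = true ∧ σ.signal = true then b = true ∨ k.val + 1 < n else b = false := by
  unfold NodeState.beaconChoice
  have hk := k.isLt
  split_ifs with h
  · rw [mem_support_coin]
    have h1 : (((n - k.val : ℕ) : ℝ≥0∞)⁻¹ ≠ 1) ↔ k.val + 1 < n := by
      rw [ne_eq, ENNReal.inv_eq_one, Nat.cast_eq_one]
      lia
    rw [h1]
    cases b <;> simp
  · simp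

section Invariants

variable {V : Type} {T n : ℕ}

/-! ### The position within a round -/

/-- The position of a phase within the timeslot. -/
def Phase.index : Phase n → ℕ
  | .pulse => 0
  | .signal k => 2 * k.val + 1
  | .listen k => 2 * k.val + 2
  | .data => 2 * n + 1
  | .receive => 2 * n + 2

theorem Phase.index_lt (ph : Phase n) : ph.index < 2 * n + 3 := by
  cases ph <;> simp only [Phase.index] <;> lia

theorem index_phaseAfter {k : ℕ} (hk : k ≤ n) : (phaseAfter n k).index = 2 * k + 1 := by
  unfold phaseAfter
  split_ifs
  · rfl
  · simp only [Phase.index]; lia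

/-- The number of steps since the last round start. -/
def Config.pos (c : Config V T n) : ℕ := c.clock.val * (2 * n + 3) + c.phase.index

theorem Config.pos_lt (c : Config V T n) : c.pos < roundLength T n := by
  have h1 := c.phase.index_lt
  have h2 : (c.clock.val + 1) * (2 * n + 3) ≤ T * (2 * n + 3) :=
    Nat.mul_le_mul_right _ c.clock.isLt
  unfold Config.pos roundLength
  lia

theorem atRoundStart_iff_pos {c : Config V T n} : AtRoundStart c ↔ c.pos = 0 := by
  obtain ⟨t, ph, st⟩ := c
  cases ph <;> simp [AtRoundStart, AtPulse, Config.pos, Phase.index]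

theorem phase_eq_receive_of_pos {c : Config V T n} (h : c.pos + 1 = roundLength T n) :
    c.phase = .receive ∧ c.clock.val + 1 = T := by
  have h1 := c.phase.index_lt
  have h2 : c.clock.val + 1 = T := by
    by_contra hne
    have h3 : (c.clock.val + 2) * (2 * n + 3) ≤ T * (2 * n + 3) :=
      Nat.mul_le_mul_right _ (by have := c.clock.isLt; lia)
    unfold Config.pos roundLength at h
    lia
  refine ⟨?_, h2⟩
  have h3 : c.phase.index = 2 * n + 2 := by
    unfold Config.pos roundLength at h
    have : (c.clock.val + 1) * (2 * n + 3) = T * (2 * n + 3) := by rw [h2]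
    lia
  revert h3
  cases c.phase <;> simp only [Phase.index, reduceCtorEq, imp_false, implies_true] <;> lia

/-! ### Invariants of a timeslot and of a round -/

/-- What holds in every configuration between the pulse and the end of a timeslot that the nodes
have entered by executing the pulse. -/
structure SlotInv (G : SimpleGraph V) (c : Config V T n) : Prop where
  of_signal : ∀ v, (c.st v).signal = true → (c.st v).sending = true ∧ (c.st v).s = some c.clock
  of_sending : ∀ v, (c.st v).sending = true → (c.st v).s = some c.clock ∨ (c.st v).s = none
  sending_of_slot : c.phase ≠ .receive → ∀ v, (c.st v).s = some c.clock → (c.st v).sending = true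
  of_heard : ∀ v, (c.st v).heard = true →
    ∃ w, G.Adj v w ∧ (c.st w).s = some c.clock ∧ (c.st w).signal = false
  of_unused : ∀ v, (c.st v).unused c.clock = false →
    ∃ w, G.Adj v w ∧ (c.st w).s = some c.clock ∧ (c.st w).signal = false
  quiet : 2 * n ≤ c.phase.index → ∀ v, (c.st v).signal = false
  heard_of_slot : c.phase = .receive →
    ∀ v w, G.Adj v w → (c.st w).s = some c.clock → (c.st v).heard = true

/-- All nodes have entered the current timeslot properly. -/
def LocalInv (G : SimpleGraph V) (c : Config V T n) : Prop := c.phase ≠ .pulse → SlotInv G c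

/-- The view of the timeslot `t` is correct at every node. -/
def ViewAt (G : SimpleGraph V) (c : Config V T n) (t : Fin T) : Prop :=
  ∀ v, (c.st v).unused t = true ↔ ∀ w, G.Adj v w → (c.st w).s ≠ some t

/-- What holds in every configuration after a round start. -/
def RoundInv (G : SimpleGraph V) (c : Config V T n) : Prop := LocalInv G c ∧ ∀ t < c.clock, ViewAt G c t

/-- A round start at which the views of all nodes are correct. -/
structure Consistent (G : SimpleGraph V) (c : Config V T n) : Prop where
  atRoundStart : AtRoundStart c
  signal : ∀ v, (c.st v).signal = false
  view : ∀ t, ViewAt G c t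

theorem RoundInv.of_atRoundStart {G : SimpleGraph V} {c : Config V T n} (h : AtRoundStart c) : RoundInv G c :=
  ⟨fun h' => absurd h.1 h', fun t ht => absurd (Fin.lt_def.1 ht) (by rw [h.2]; lia)⟩

end Invariants

/-! ### Possible steps and the preservation of the invariants -/

section Dynamics

variable {V : Type} [Fintype V] [DecidableEq V] {T n : ℕ}
variable {G : SimpleGraph V} [DecidableRel G.Adj]

theorem mem_support_step_pulse {t : Fin T} {st : V → NodeState T} {c' : Config V T n} :
    c' ∈ (step G ⟨t, .pulse, st⟩).support ↔
      ∃ ch : V → Option (Fin T), (∀ v, ch v ∈ ((st v).slotChoice t).support) ∧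
        c' = ⟨t, phaseAfter n 0, fun v => (st v).onTimeslot t (ch v)⟩ := by
  simp only [step, PMF.support_map, Set.mem_image, mem_support_independent, eq_comm]

theorem mem_support_step_signal {t : Fin T} {k : Fin n} {st : V → NodeState T}
    {c' : Config V T n} :
    c' ∈ (step G ⟨t, .signal k, st⟩).support ↔
      ∃ b, (∀ v, b v ∈ ((st v).beaconChoice k).support) ∧
        c' = ⟨t, .listen k, deliver G b fun v => (st v).onBeacon (b v)⟩ := by
  simp only [step, PMF.support_map, Set.mem_image, mem_support_independent, eq_comm]

theorem mem_support_step_listen {t : Fin T} {k : Fin n} {st : V → NodeState T}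
    {c' : Config V T n} :
    c' ∈ (step G ⟨t, .listen k, st⟩).support ↔
      c' = ⟨t, phaseAfter n (k.val + 1), fun v => (st v).onListen t⟩ := by
  simp [step]

theorem mem_support_step_data {t : Fin T} {st : V → NodeState T} {c' : Config V T n} :
    c' ∈ (step G ⟨t, .data, st⟩).support ↔
      c' = ⟨t, .receive, deliver G (fun v => (st v).sendsData) fun v => (st v).onData⟩ := by
  simp [step]

theorem mem_support_step_receive {t : Fin T} {st : V → NodeState T} {c' : Config V T n} :
    c' ∈ (step G ⟨t, .receive, st⟩).support ↔
      c' = ⟨nextClock t, .pulse, fun v => (st v).onListen t⟩ := by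
  simp [step]

theorem pos_step {c c' : Config V T n} (h : c' ∈ (step G c).support) :
    c'.pos = (c.pos + 1) % roundLength T n := by
  have key : c'.pos = c.pos + 1 ∨ (c'.pos = 0 ∧ c.pos + 1 = roundLength T n) := by
    obtain ⟨t, ph, st⟩ := c
    cases ph with
    | pulse =>
      obtain ⟨ch, -, rfl⟩ := mem_support_step_pulse.1 h
      left
      simp only [Config.pos, index_phaseAfter (Nat.zero_le n)]
      simp only [Phase.index]
    | signal k =>
      obtain ⟨b, -, rfl⟩ := mem_support_step_signal.1 h
      left
      simp only [Config.pos, Phase.index]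
      lia
    | listen k =>
      obtain rfl := mem_support_step_listen.1 h
      left
      have := index_phaseAfter (n := n) (k := k.val + 1) k.isLt
      simp only [Config.pos, this]
      simp only [Phase.index]
      lia
    | data =>
      obtain rfl := mem_support_step_data.1 h
      left
      simp only [Config.pos, Phase.index]
      lia
    | receive =>
      obtain rfl := mem_support_step_receive.1 h
      have ht := t.isLt
      rcases eq_or_ne (t.val + 1) T with e | e
      · right
        simp only [Config.pos, nextClock, roundLength, Phase.index, e, Nat.mod_self]
        refine ⟨by simp, ?_⟩
        have : (t.val + 1) * (2 * n + 3) = T * (2 * n + 3) := by rw [e]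
        lia
      · left
        simp only [Config.pos, nextClock, Phase.index, Nat.mod_eq_of_lt (show t.val + 1 < T by lia)]
        ring
  rcases key with h1 | ⟨h1, h2⟩
  · rw [← h1, Nat.mod_eq_of_lt c'.pos_lt]
  · rw [h1, h2, Nat.mod_self]

theorem phaseAfter_ne_receive {k : ℕ} : phaseAfter n k ≠ .receive := by
  unfold phaseAfter; split_ifs <;> simp

theorem onListen_s {t : Fin T} {σ : NodeState T} : (σ.onListen t).s =
    if σ.heard = true ∧ σ.s = some t ∧ σ.signal = true then none else σ.s := by
  unfold NodeState.onListen NodeState.onCarrierSense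
  split_ifs <;> simp_all

theorem onListen_signal {t : Fin T} {σ : NodeState T} :
    (σ.onListen t).signal = (σ.signal && !σ.heard) := by
  unfold NodeState.onListen NodeState.onCarrierSense
  split_ifs <;> simp_all

theorem onListen_sending {t : Fin T} {σ : NodeState T} :
    (σ.onListen t).sending = σ.sending := by
  unfold NodeState.onListen NodeState.onCarrierSense
  split_ifs <;> simp_all

theorem onListen_heard {t : Fin T} {σ : NodeState T} : (σ.onListen t).heard = false := rfl

theorem onListen_unused {t u : Fin T} {σ : NodeState T} : (σ.onListen t).unused u =
    if u = t ∧ σ.heard = true then false else σ.unused u := by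
  unfold NodeState.onListen NodeState.onCarrierSense
  split_ifs <;> simp_all

/-- The clause `signal = false` for the witnesses in `of_heard` and `of_unused` makes the induction
work: `carrier_sense` clears the slot only of nodes that still compete, so these witnesses keep
theirs to the end of the timeslot. -/
theorem LocalInv.step {c c' : Config V T n} (hn : 0 < n) (hc : LocalInv G c)
    (h : c' ∈ (step G c).support) : LocalInv G c' := by
  obtain ⟨t, ph, st⟩ := c
  cases ph with
  | pulse =>
    obtain ⟨ch, -, rfl⟩ := mem_support_step_pulse.1 h
    refine fun _ => ⟨?_, ?_, ?_, ?_, ?_, ?_, ?_⟩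
    · simp +contextual [NodeState.onTimeslot]
    · simp +contextual [NodeState.onTimeslot]
    · simp +contextual [NodeState.onTimeslot]
    · simp [NodeState.onTimeslot]
    · simp [NodeState.onTimeslot]
    · simp only [index_phaseAfter hn.le]
      lia
    · simp [phaseAfter_ne_receive]
  | signal k =>
    obtain ⟨b, hb, rfl⟩ := mem_support_step_signal.1 h
    simp only [mem_support_beaconChoice] at hb
    obtain ⟨h1, h2, h3, h4, h5, h6, h7⟩ := hc (by simp)
    simp only [ne_eq, reduceCtorEq, not_false_eq_true, forall_const] at h1 h2 h3 h4 h5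
    refine fun _ => ⟨?_, ?_, ?_, ?_, ?_, ?_, ?_⟩ <;>
      simp only [deliver, NodeState.onBeacon, Phase.index, reduceCtorEq, decide_eq_true_eq,
        IsEmpty.forall_iff, Bool.and_eq_true, Bool.and_eq_false_iff, Bool.not_eq_true',
        Bool.not_eq_false']
    · exact fun v hv => h1 v hv.1
    · exact h2
    · exact fun _ => h3
    · rintro v ⟨w, hw, hbw⟩
      have := hb w
      grind
    · intro v hv
      obtain ⟨w, hw⟩ := h5 v hv
      exact ⟨w, by grind⟩
    -- Here `hk` forces `k` to be the last period, in which every remaining competitor sends its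
    -- beacon and quits.
    · intro hk v
      have := hb v
      have := h1 v
      have := k.isLt
      grind
  | listen k =>
    obtain rfl := mem_support_step_listen.1 h
    obtain ⟨h1, h2, h3, h4, h5, h6, h7⟩ := hc (by simp)
    simp only [ne_eq, reduceCtorEq, not_false_eq_true, forall_const] at h1 h2 h3 h4 h5
    refine fun _ => ⟨?_, ?_, ?_, ?_, ?_, ?_, ?_⟩ <;>
      simp only [onListen_s, onListen_signal, onListen_sending, onListen_heard, onListen_unused,
        phaseAfter_ne_receive, IsEmpty.forall_iff, Bool.and_eq_true, Bool.and_eq_false_iff,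
        Bool.not_eq_true', Bool.not_eq_false', reduceCtorEq, implies_true, true_and]
    · intro v hv
      have := h1 v hv.1
      grind
    · intro v hv
      have := h2 v hv
      grind
    · intro _ v hv
      exact h3 v (by grind)
    -- A mark is false either from before or because of the event just handled; both provide a
    -- witness, which no longer competes and so keeps its slot.
    · intro v hv
      have : ∃ w, G.Adj v w ∧ (st w).s = some t ∧ (st w).signal = false := by
        by_cases hh : (st v).heard = true
        · exact h4 v hh
        · exact h5 v (by grind)
      obtain ⟨w, hw⟩ := this
      exact ⟨w, by grind⟩
    · rw [index_phaseAfter k.isLt]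
      intro hk v
      exact .inl (h6 (by simp only [Phase.index]; lia) v)
  | data =>
    obtain rfl := mem_support_step_data.1 h
    obtain ⟨h1, h2, h3, h4, h5, h6, h7⟩ := hc (by simp)
    simp only [ne_eq, reduceCtorEq, not_false_eq_true, forall_const] at h1 h2 h3 h4 h5
    replace h6 : ∀ v, (st v).signal = false := h6 (by simp only [Phase.index]; lia)
    refine fun _ => ⟨?_, ?_, ?_, ?_, ?_, ?_, ?_⟩ <;>
      simp only [deliver, NodeState.onData, NodeState.sendsData, reduceCtorEq, decide_eq_true_eq,
        IsEmpty.forall_iff, Bool.and_eq_true, not_true_eq_false, implies_true, h6, and_true,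
        ne_eq]
    -- A node in `send` has the current slot or none, so a transmitter of DATA uses the current
    -- slot.
    · rintro v ⟨w, hw, hs, hi⟩
      have := h2 w hs
      exact ⟨w, hw, by grind⟩
    · intro v hv
      obtain ⟨w, hw, hs, -⟩ := h5 v hv
      exact ⟨w, hw, hs⟩
    · intro _ v w hw hs
      exact ⟨w, hw, h3 w hs, by simp [hs]⟩
  | receive =>
    obtain rfl := mem_support_step_receive.1 h
    exact fun h => absurd rfl h

/-- Timeslots other than the current one are not affected by a step other than the round start. -/
theorem step_of_ne {c c' : Config V T n} (h : c' ∈ (step G c).support)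
    (h0 : ¬ AtRoundStart c) {t : Fin T} (ht : t ≠ c.clock) (v : V) :
    (c'.st v).unused t = (c.st v).unused t ∧ ((c'.st v).s = some t ↔ (c.st v).s = some t) := by
  obtain ⟨u, ph, st⟩ := c
  simp only at ht
  cases ph with
  | pulse =>
    obtain ⟨ch, hch, rfl⟩ := mem_support_step_pulse.1 h
    have hu : u.val ≠ 0 := fun hu => h0 ⟨rfl, hu⟩
    have := hch v
    rw [mem_support_slotChoice, if_neg (by simp [hu])] at this
    simp [NodeState.onTimeslot, this, ht]
  | signal k =>
    obtain ⟨b, -, rfl⟩ := mem_support_step_signal.1 h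
    simp [deliver, NodeState.onBeacon]
  | listen k =>
    obtain rfl := mem_support_step_listen.1 h
    simp only [onListen_s, onListen_unused]
    grind
  | data =>
    obtain rfl := mem_support_step_data.1 h
    simp [deliver, NodeState.onData]
  | receive =>
    obtain rfl := mem_support_step_receive.1 h
    simp only [onListen_s, onListen_unused]
    grind

theorem ViewAt.step {c c' : Config V T n} {t : Fin T} (hv : ViewAt G c t)
    (h : c' ∈ (step G c).support) (h0 : ¬ AtRoundStart c) (ht : t ≠ c.clock) :
    ViewAt G c' t := by
  intro v
  have h1 := fun v => step_of_ne h h0 ht v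
  rw [(h1 v).1, hv v]
  refine forall₂_congr fun w _ => not_congr (h1 w).2.symm

/-- Nobody competes any more, so no slot is lost. The mark is correct because every neighbor using
the slot is heard, and every heard event or earlier mark has such a neighbor as its witness. -/
theorem step_receive {c c' : Config V T n} (hc : LocalInv G c) (h : c' ∈ (step G c).support)
    (hr : c.phase = .receive) :
    (∀ v, (c'.st v).signal = false) ∧ (∀ v, (c'.st v).s = (c.st v).s) ∧ ViewAt G c' c.clock := by
  obtain ⟨t, ph, st⟩ := c
  obtain rfl : ph = .receive := hr
  obtain rfl := mem_support_step_receive.1 h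
  obtain ⟨h1, h2, h3, h4, h5, h6, h7⟩ := hc (by simp)
  simp only [forall_const] at h4 h5 h7
  replace h6 : ∀ v, (st v).signal = false := h6 (by simp only [Phase.index]; lia)
  refine ⟨fun v => by simp [onListen_signal, h6], fun v => by simp [onListen_s, h6], fun v => ?_⟩
  simp only [onListen_s, onListen_unused, h6, true_and, Bool.false_eq_true, and_false, if_false]
  have := h7 v
  have := h4 v
  have := h5 v
  cases hh : (st v).heard <;> cases hu : (st v).unused t <;> grind

theorem clock_step {c c' : Config V T n} (h : c' ∈ (step G c).support) :
    c'.clock = if c.phase = .receive then nextClock c.clock else c.clock := by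
  obtain ⟨t, ph, st⟩ := c
  cases ph with
  | pulse =>
    obtain ⟨ch, -, rfl⟩ := mem_support_step_pulse.1 h
    simp
  | signal k =>
    obtain ⟨b, -, rfl⟩ := mem_support_step_signal.1 h
    simp
  | listen k =>
    obtain rfl := mem_support_step_listen.1 h
    simp
  | data =>
    obtain rfl := mem_support_step_data.1 h
    simp
  | receive =>
    obtain rfl := mem_support_step_receive.1 h
    simp

theorem RoundInv.step {c c' : Config V T n} (hn : 0 < n) (hc : RoundInv G c)
    (h : c' ∈ (step G c).support) : RoundInv G c' := by
  refine ⟨hc.1.step hn h, fun t ht => ?_⟩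
  rw [clock_step h] at ht
  -- The selection of slots at a round start could spoil a view, but there the clock is 0 and no
  -- earlier slot exists.
  have h0 : t ≤ c.clock → ¬ AtRoundStart c ∨ t = c.clock := fun ht' => by
    by_cases h0 : AtRoundStart c
    · right
      have := h0.2
      exact Fin.ext (by have := Fin.le_def.1 ht'; lia)
    · exact .inl h0
  split_ifs at ht with hr
  · have hle : t ≤ c.clock := by
      have h1 : t.val < (c.clock.val + 1) % T := Fin.lt_def.1 ht
      have := Nat.mod_le (c.clock.val + 1) T
      exact Fin.le_def.2 (by lia)
    rcases eq_or_ne t c.clock with rfl | hne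
    · exact (step_receive hc.1 h hr).2.2
    · exact (hc.2 t (lt_of_le_of_ne hle hne)).step h ((h0 hle).resolve_right hne) hne
  · exact (hc.2 t ht).step h ((h0 ht.le).resolve_right ht.ne) ht.ne

theorem RoundInv.consistent {c c' : Config V T n} (hc : RoundInv G c)
    (h : c' ∈ (TDMA.step G c).support) (hp : c.pos + 1 = roundLength T n) : Consistent G c' := by
  obtain ⟨hr, hT⟩ := phase_eq_receive_of_pos hp
  obtain ⟨h1, -, h3⟩ := step_receive hc.1 h hr
  refine ⟨?_, h1, fun t => ?_⟩
  · rw [atRoundStart_iff_pos, pos_step h, hp, Nat.mod_self]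
  · rcases eq_or_ne t c.clock with rfl | hne
    · exact h3
    · have : t < c.clock := by
        have := t.isLt
        have : t.val ≠ c.clock.val := fun h => hne (Fin.ext h)
        exact Fin.lt_def.2 (by lia)
      refine (hc.2 t this).step h (fun h0 => ?_) hne
      rw [h0.1] at hr
      simp at hr

/-! ### Timeslots that are in exclusive use -/

/-- The node `i` uses the timeslot `t`, and no neighbor does. -/
def Holds (G : SimpleGraph V) (c : Config V T n) (i : V) (t : Fin T) : Prop :=
  (c.st i).s = some t ∧ ∀ w, G.Adj i w → (c.st w).s ≠ some t

/-- To lose `t`, node `i` must hear something in slot `t`, and by `of_heard` some neighbor would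
then use `t`. A neighbor can acquire `t` only by selection at a round start, which `hw` rules out.
-/
theorem Holds.step {c c' : Config V T n} {i : V} {t : Fin T} (hc : LocalInv G c)
    (hi : Holds G c i t)
    (hw : AtRoundStart c → ∀ w, G.Adj i w → (c.st w).s = none → (c.st w).unused t = false)
    (h : c' ∈ (step G c).support) : Holds G c' i t := by
  obtain ⟨u, ph, st⟩ := c
  obtain ⟨hi, hj⟩ := hi
  simp only at hi hj
  cases ph with
  | pulse =>
    obtain ⟨ch, hch, rfl⟩ := mem_support_step_pulse.1 h
    simp only [mem_support_slotChoice] at hch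
    refine ⟨?_, fun w hiw => ?_⟩ <;> simp only [NodeState.onTimeslot]
    · have := hch i
      grind
    · have h1 := hch w
      have h2 := hj w hiw
      split_ifs at h1 with h3
      · have := hw ⟨rfl, h3.1⟩ w hiw h3.2
        grind
      · grind
  | signal k =>
    obtain ⟨b, -, rfl⟩ := mem_support_step_signal.1 h
    exact ⟨hi, hj⟩
  | listen k =>
    obtain rfl := mem_support_step_listen.1 h
    have := (hc (by simp)).of_heard i
    simp only at this
    refine ⟨?_, fun w hiw => ?_⟩ <;> simp only [onListen_s]
    · grind
    · have := hj w hiw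
      grind
  | data =>
    obtain rfl := mem_support_step_data.1 h
    exact ⟨hi, hj⟩
  | receive =>
    have h1 := (step_receive hc h rfl).2.1
    exact ⟨(h1 i).trans hi, fun w hiw => by rw [h1 w]; exact hj w hiw⟩

end Dynamics

/-! ### Exclusive use, allocation and legality -/

section Allocation

variable {V : Type} {T n : ℕ} {G : SimpleGraph V}

theorem Consistent.viewCorrect {c : Config V T n} (hc : Consistent G c) (i : V) :
    ViewCorrect G c i := fun t _ => hc.view t i

theorem Holds.allocated {c : Config V T n} {i : V} {t : Fin T} (h : Holds G c i t)
    (hc : Consistent G c) : Allocated G c i := by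
  obtain ⟨hi, hw⟩ := h
  refine ⟨hc.signal i, hc.viewCorrect i, .inl (by simp [hi]), by simp [HasSlot, hi], ?_⟩
  refine fun j hj => ⟨fun h => hw j hj (h ▸ hi), fun u hu => ?_⟩
  by_contra hne
  exact (hc.view u j).1 (by simpa using hne) i hj.symm hu

theorem exists_holds_of_hasSlot {c : Config V T n} {i : V} (hs : (c.st i).s ≠ none)
    (hw : ∀ j, G.Adj i j → (c.st i).s ≠ (c.st j).s) : ∃ t, Holds G c i t := by
  obtain ⟨t, ht⟩ := Option.ne_none_iff_exists'.1 hs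
  exact ⟨t, ht, fun w hiw h => hw w hiw (ht.trans h.symm)⟩

theorem Allocated.exists_holds {c : Config V T n} {i : V} (h : Allocated G c i) :
    ∃ t, Holds G c i t :=
  exists_holds_of_hasSlot h.2.2.2.1 fun j hj => (h.2.2.2.2 j hj).1

theorem legal_of_forall_holds {c : Config V T n} (h : ∀ i, ∃ t, Holds G c i t) :
    Legal G c := by
  intro i
  obtain ⟨t, hi, hw⟩ := h i
  exact ⟨fun _ j hj h => hw j hj (h ▸ hi), fun h => by simp [hi] at h⟩

theorem Consistent.unused_eq_false {c : Config V T n} (hc : Consistent G c) {i w : V}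
    {t : Fin T} (hi : Holds G c i t) (hw : G.Adj i w) : (c.st w).unused t = false := by
  by_contra h
  exact (hc.view t w).1 (by simpa using h) i hw.symm hi.1

variable [Fintype V] [DecidableRel G.Adj]

/-- A node of degree less than `T` has a timeslot that no neighbor uses. -/
theorem exists_free_slot (c : Config V T n) {i : V} (hd : G.degree i < T) :
    ∃ t : Fin T, ∀ w, G.Adj i w → (c.st w).s ≠ some t := by
  classical
  by_contra! h
  have hsub : (Finset.univ : Finset (Fin T)).image some ⊆
      (G.neighborFinset i).image fun w => (c.st w).s := by
    intro a ha
    obtain ⟨t, -, rfl⟩ := Finset.mem_image.1 ha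
    obtain ⟨w, hw, hs⟩ := h t
    exact Finset.mem_image.2 ⟨w, by simpa using hw, hs⟩
  have h1 := (Finset.card_le_card hsub).trans Finset.card_image_le
  rw [Finset.card_image_of_injective _ (Option.some_injective _)] at h1
  simp at h1
  lia

theorem Consistent.hasOption {c : Config V T n} (hc : Consistent G c) {i : V}
    (hd : G.degree i < T) : HasOption c i := by
  obtain ⟨t, ht⟩ := exists_free_slot c hd
  by_cases hs : (c.st i).s = none
  · exact .inr ⟨t, by simpa [NodeState.unusedSet] using (hc.view t i).2 ht, by simp [hs]⟩
  · exact .inl hs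

theorem Consistent.ready_or_obtaining_or_allocated {c : Config V T n} (hc : Consistent G c)
    {i : V} (hd : G.degree i < T) : Ready G c i ∨ Obtaining G c i ∨ Allocated G c i := by
  have h1 : NotSignaling c i := hc.signal i
  have h2 := hc.viewCorrect i
  have h3 := hc.hasOption hd
  by_cases h4 : HasSlot c i
  · by_cases h5 : SlotRespected G c i
    · exact .inr (.inr ⟨h1, h2, h3, h4, h5⟩)
    · exact .inr (.inl ⟨h1, h2, h3, h4, h5⟩)
  · exact .inl ⟨h1, h2, h3, h4⟩

/-- Legality lets a node be without slot only if its neighbors use all `T` of them, which a degree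
below `T` excludes. -/
theorem Legal.forall_holds {c : Config V T n} (hd : ∀ i, G.degree i < T) (h : Legal G c) (i : V) :
    ∃ t, Holds G c i t := by
  refine exists_holds_of_hasSlot (fun hs => ?_) ?_
  · obtain ⟨t, ht⟩ := exists_free_slot c (hd i)
    obtain ⟨j, hj, hjt⟩ := (h i).2 hs t
    exact ht j hj hjt
  · refine (h i).1 fun hs => ?_
    obtain ⟨t, ht⟩ := exists_free_slot c (hd i)
    obtain ⟨j, hj, hjt⟩ := (h i).2 hs t
    exact ht j hj hjt

end Allocation

section Paths

variable {V : Type} [Fintype V] [DecidableEq V] {T n : ℕ}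
variable {G : SimpleGraph V} [DecidableRel G.Adj]

/-! ### Invariants along paths -/

theorem Reach.pos {c x : Config V T n} {k : ℕ} (h : Reach G c k x) :
    x.pos = (c.pos + k) % roundLength T n := by
  induction h with
  | refl => rw [add_zero, Nat.mod_eq_of_lt c.pos_lt]
  | tail _ hy ih => rw [pos_step hy, ih, Nat.mod_add_mod, add_assoc]

theorem Reach.roundInv (hn : 0 < n) {c x : Config V T n} {k : ℕ} (h : Reach G c k x)
    (hc : RoundInv G c) : RoundInv G x := by
  induction h with
  | refl => exact hc
  | tail _ hy ih => exact ih.step hn hy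

theorem exists_reach (c : Config V T n) (k : ℕ) : ∃ x, Reach G c k x := by
  induction k with
  | zero => exact ⟨c, .refl⟩
  | succ k ih =>
    obtain ⟨x, hx⟩ := ih
    obtain ⟨y, hy⟩ := (step G x).support_nonempty
    exact ⟨y, hx.tail hy⟩

theorem IsExecution.reach {R : ℕ → Config V T n} (hR : IsExecution G R) (m k : ℕ) :
    Reach G (R m) k (R (m + k)) := by
  induction k with
  | zero => exact .refl
  | succ k ih => exact ih.tail (hR (m + k))

theorem exists_isExecution (c : Config V T n) :
    ∃ R : ℕ → Config V T n, IsExecution G R ∧ R 0 = c := by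
  choose f hf using fun x : Config V T n => (step G x).support_nonempty
  refine ⟨fun m => f^[m] c, fun m => ?_, rfl⟩
  simp only [Function.iterate_succ_apply']
  exact hf _

/-- Every round start after the first one is consistent. -/
theorem Reach.consistent (hn : 0 < n) {c x : Config V T n} {k : ℕ} (h : Reach G c k x)
    (hc : AtRoundStart c) (hk : 0 < k) (hx : AtRoundStart x) : Consistent G x := by
  cases h with
  | refl => exact absurd hk (lt_irrefl 0)
  | @tail m y _ hy hxy =>
    refine (hy.roundInv hn (.of_atRoundStart hc)).consistent hxy ?_
    have h1 := pos_step hxy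
    rw [atRoundStart_iff_pos.1 hx] at h1
    have h2 := y.pos_lt
    by_contra hne
    rw [Nat.mod_eq_of_lt (by lia)] at h1
    lia

theorem roundLength_pos (hT : 0 < T) : 0 < roundLength T n := by
  unfold roundLength; positivity

theorem Reach.atRoundStart {c x : Config V T n} {y : ℕ} (hc : AtRoundStart c)
    (h : Reach G c (y * roundLength T n) x) : AtRoundStart x := by
  rw [atRoundStart_iff_pos, h.pos, atRoundStart_iff_pos.1 hc]
  simp

/-- A timeslot in exclusive use at a consistent round start remains so. -/
theorem Holds.reach (hn : 0 < n) {c x : Config V T n} {k : ℕ} {i : V} {t : Fin T}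
    (hi : Holds G c i t) (hc : Consistent G c) (h : Reach G c k x) : Holds G x i t := by
  induction h with
  | refl => exact hi
  | @tail m x y hx hy ih =>
    refine ih.step (hx.roundInv hn (.of_atRoundStart hc.atRoundStart)).1
      (fun h0 w hw _ => ?_) hy
    -- Views matter only at round starts: the initial one is consistent by hypothesis, later ones
    -- because a full round precedes them.
    have : Consistent G x := by
      rcases Nat.eq_zero_or_pos m with rfl | hm
      · cases hx
        exact hc
      · exact hx.consistent hn hc.atRoundStart hm h0
    exact this.unused_eq_false ih hw

/-- If all nodes are in exclusive use of their timeslots at a pulse, then they remain so. -/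
theorem IsExecution.forall_holds (hn : 0 < n) {R : ℕ → Config V T n} (hR : IsExecution G R)
    (h0 : AtPulse (R 0)) (h : ∀ i, ∃ t, Holds G (R 0) i t) (m : ℕ) :
    LocalInv G (R m) ∧ ∀ i, ∃ t, Holds G (R m) i t := by
  induction m with
  | zero => exact ⟨fun h' => absurd h0 h', h⟩
  | succ m ih =>
    refine ⟨ih.1.step hn (hR m), fun i => ?_⟩
    obtain ⟨t, ht⟩ := ih.2 i
    refine ⟨t, ht.step ih.1 (fun _ w _ hs => ?_) (hR m)⟩
    -- No node is without slot, so no selection can take place, whatever the views are.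
    obtain ⟨u, hu, -⟩ := ih.2 w
    simp [hu] at hs

theorem IsExecution.mem_LE (hn : 0 < n) {R : ℕ → Config V T n} (hR : IsExecution G R)
    (h0 : AtPulse (R 0)) (h : ∀ i, ∃ t, Holds G (R 0) i t) : R ∈ LE G :=
  ⟨hR, fun m => legal_of_forall_holds (hR.forall_holds hn h0 h m).2⟩

theorem AllAllocated.safe (hn : 0 < n) {c : Config V T n} (hc : AllAllocated G c) :
    Safe G c := by
  obtain ⟨R, hR, rfl⟩ := exists_isExecution (G := G) c
  exact ⟨R, hR.mem_LE hn hc.1.1 fun i => (hc.2 i).exists_holds, rfl⟩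

/-! ### Obtaining a timeslot -/

/-- The node `i` is on its way to the exclusive use of the timeslot `t`: this timeslot has not
started yet, or `i` is about to send the only beacon of the first period, or it has just done so,
or it has won. -/
def Aims (G : SimpleGraph V) (c : Config V T n) (i : V) (t : Fin T) : Prop :=
  (c.st i).s = some t ∧
    (c.clock < t ∨
      (c.clock = t ∧ c.phase = .pulse) ∨
      (c.clock = t ∧ (∃ k : Fin n, k.val = 0 ∧ c.phase = .signal k) ∧
        ∀ w, (c.st w).s = some t → (c.st w).signal = true ∧ (c.st w).sending = true) ∨
      (c.clock = t ∧ (∃ k : Fin n, k.val = 0 ∧ c.phase = .listen k) ∧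
        (c.st i).signal = false ∧
        ∀ w, G.Adj i w → (c.st w).s = some t →
          (c.st w).signal = true ∧ (c.st w).heard = true) ∨
      ∀ w, G.Adj i w → (c.st w).s ≠ some t)

/-- The only outcome to be steered is the first period of slot `t`, where `i` alone sends a beacon;
before and after it any step will do. -/
theorem Aims.exists_step (hn : 2 ≤ n) {c : Config V T n} {i : V} {t : Fin T}
    (hc : LocalInv G c) (h0 : ¬ AtRoundStart c) (h : Aims G c i t) :
    ∃ c' ∈ (step G c).support, Aims G c' i t := by
  obtain ⟨hi, hlt | ⟨hct, hp⟩ | ⟨hct, ⟨k, hk, hp⟩, hw⟩ | ⟨hct, ⟨k, hk, hp⟩, hsi, hw⟩ | hw⟩ := h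
  · obtain ⟨c', hc'⟩ := (step G c).support_nonempty
    refine ⟨c', hc', ((step_of_ne hc' h0 hlt.ne' i).2).2 hi, ?_⟩
    have hcl := clock_step hc'
    split_ifs at hcl with hr
    · have hlt' := Fin.lt_def.1 hlt
      have h1 : c'.clock.val = c.clock.val + 1 := by
        rw [hcl]
        exact Nat.mod_eq_of_lt (by have := t.isLt; lia)
      rcases Nat.lt_or_ge c'.clock.val t.val with h2 | h2
      · exact .inl h2
      · refine .inr (.inl ⟨Fin.ext (by lia), ?_⟩)
        obtain ⟨u, ph, st⟩ := c
        obtain rfl : ph = .receive := hr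
        rw [mem_support_step_receive.1 hc']
    · exact .inl (hcl ▸ hlt)
  · obtain ⟨u, ph, st⟩ := c
    obtain rfl : u = t := hct
    obtain rfl : ph = .pulse := hp
    have hu : u.val ≠ 0 := fun hu => h0 ⟨rfl, hu⟩
    refine ⟨_, mem_support_step_pulse.2 ⟨fun v => (st v).s, fun v => ?_, rfl⟩, hi, ?_⟩
    · rw [mem_support_slotChoice, if_neg (by simp [hu])]
    · refine .inr (.inr (.inl ⟨rfl, ⟨⟨0, by lia⟩, rfl, ?_⟩, ?_⟩))
      · simp [phaseAfter, show 0 < n by lia]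
      · simp [NodeState.onTimeslot]
  · obtain ⟨u, ph, st⟩ := c
    obtain rfl : u = t := hct
    obtain rfl : ph = .signal k := hp
    simp only at hw hi
    -- Silence of the other competitors is possible since `k = 0` is not the last period when `n ≥
    -- 2`.
    refine ⟨_, mem_support_step_signal.2 ⟨fun v => decide (v = i), fun v => ?_, rfl⟩, hi, ?_⟩
    · rw [mem_support_beaconChoice]
      have := hw i hi
      grind
    · refine .inr (.inr (.inr (.inl ⟨rfl, ⟨k, hk, rfl⟩, ?_, ?_⟩)))
      · simp [deliver, NodeState.onBeacon]
      · intro w hiw hs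
        have := hw w hs
        have := hiw.ne'
        simp_all [deliver, NodeState.onBeacon, hiw.symm]
  · obtain ⟨u, ph, st⟩ := c
    obtain rfl : u = t := hct
    obtain rfl : ph = .listen k := hp
    simp only at hw hi hsi
    -- Every neighbor with slot `t` still competes and has heard `i`, so it drops `t`; `i` no longer
    -- competes and keeps it.
    refine ⟨_, mem_support_step_listen.2 rfl, ?_, .inr (.inr (.inr (.inr fun w hiw => ?_)))⟩
    · simp [onListen_s, hi, hsi]
    · have := hw w hiw
      simp only [onListen_s]
      grind
  · obtain ⟨c', hc'⟩ := (step G c).support_nonempty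
    have := Holds.step (t := t) hc ⟨hi, hw⟩ (fun h => absurd h h0) hc'
    exact ⟨c', hc', this.1, .inr (.inr (.inr (.inr this.2)))⟩

theorem exists_step_aims (hn : 2 ≤ n) {c : Config V T n} {i : V} (h0 : AtRoundStart c)
    (h : HasOption c i) : ∃ c' ∈ (step G c).support, ∃ t, Aims G c' i t := by
  obtain ⟨u, ph, st⟩ := c
  obtain ⟨hp, hu⟩ := h0
  obtain rfl : ph = .pulse := hp
  simp only at hu
  have hch : ∃ t, some t ∈ ((st i).slotChoice u).support := by
    simp only [mem_support_slotChoice]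
    rcases hs : (st i).s with _ | t
    · rcases h with h | ⟨t, ht, -⟩
      · exact absurd hs h
      · exact ⟨t, by simpa [hu, NodeState.unusedSet] using ht⟩
    · exact ⟨t, by simp⟩
  obtain ⟨t, ht⟩ := hch
  choose f hf using fun v => ((st v).slotChoice u).support_nonempty
  refine ⟨_, mem_support_step_pulse.2 ⟨Function.update f i (some t), fun v => ?_, rfl⟩, t, ?_, ?_⟩
  · rcases eq_or_ne v i with rfl | hv
    · simpa using ht
    · simpa [hv] using hf v
  · simp [NodeState.onTimeslot]
  -- If `t` is slot 0, its pulse is the step just made and the first period is next; otherwise slot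
  -- `t` is still ahead.
  · rcases eq_or_ne u t with rfl | hut
    · refine .inr (.inr (.inl ⟨rfl, ⟨⟨0, by lia⟩, rfl, ?_⟩, ?_⟩))
      · simp [phaseAfter, show 0 < n by lia]
      · simp [NodeState.onTimeslot]
    · left
      have : u.val ≠ t.val := fun h => hut (Fin.ext h)
      exact Fin.lt_def.2 (by simp only; lia)

/-- A node with an option can obtain exclusive use of a timeslot within the next round. -/
theorem exists_reach_holds (hn : 2 ≤ n) {c : Config V T n} {i : V} (h0 : AtRoundStart c)
    (h : HasOption c i) :
    ∃ x t, Reach G c (roundLength T n) x ∧ Consistent G x ∧ Holds G x i t := by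
  have hN : 2 ≤ roundLength T n := by
    have := Nat.mul_le_mul_right (2 * n + 3) (Nat.succ_le_of_lt 
      (c.clock.val.zero_le.trans_lt c.clock.isLt))
    unfold roundLength
    lia
  obtain ⟨c₁, hc₁, t, ht⟩ := exists_step_aims (G := G) hn h0 h
  -- The path stays at positions 1 to `roundLength T n - 1`, so it meets no round start and
  -- `Aims.exists_step` applies throughout.
  have hpath : ∀ k, k + 1 < roundLength T n → ∃ x, Reach G c (k + 1) x ∧ Aims G x i t := by
    intro k
    induction k with
    | zero => exact fun _ => ⟨c₁, .tail .refl hc₁, ht⟩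
    | succ k ih =>
      intro hk
      obtain ⟨x, hx, hxt⟩ := ih (by lia)
      obtain ⟨y, hy, hyt⟩ := hxt.exists_step hn
        (hx.roundInv (by lia) (.of_atRoundStart h0)).1 (fun h1 => by
          have h2 := hx.pos
          rw [atRoundStart_iff_pos.1 h0, atRoundStart_iff_pos.1 h1, zero_add,
            Nat.mod_eq_of_lt (by lia)] at h2
          lia)
      exact ⟨y, hx.tail hy, hyt⟩
  obtain ⟨x, hx, hxt⟩ := hpath (roundLength T n - 2) (by lia)
  have hxp : x.pos + 1 = roundLength T n := by
    rw [hx.pos, atRoundStart_iff_pos.1 h0, zero_add, Nat.mod_eq_of_lt (by lia)]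
    lia
  obtain ⟨hr, hcl⟩ := phase_eq_receive_of_pos hxp
  have hinv := hx.roundInv (by lia) (.of_atRoundStart h0)
  -- In the last step of the last slot, `t` cannot lie ahead and the phase is `receive`, so only the
  -- winning alternative of `Aims` is left.
  have hxh : Holds G x i t := by
    obtain ⟨hi, h1 | ⟨-, h1⟩ | ⟨-, ⟨k, -, h1⟩, -⟩ | ⟨-, ⟨k, -, h1⟩, -⟩ | h1⟩ := hxt
    · have := Fin.lt_def.1 h1
      have := t.isLt
      lia
    · simp [hr] at h1
    · simp [hr] at h1
    · simp [hr] at h1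
    · exact ⟨hi, h1⟩
  obtain ⟨y, hy⟩ := (step G x).support_nonempty
  refine ⟨y, t, ?_, hinv.consistent hy hxp, hxh.step hinv.1 (fun h1 => ?_) hy⟩
  · have := hx.tail hy
    rwa [show roundLength T n - 2 + 1 + 1 = roundLength T n by lia] at this
  · rw [h1.1] at hr
    simp at hr

/-- Induction on the number of nodes without exclusive use of a slot: a suitable round wins one more
node, and `Holds.reach` keeps all the earlier ones. -/
theorem Consistent.exists_reach_allAllocated (hn : 2 ≤ n) (hd : ∀ i, G.degree i < T)
    {c : Config V T n} (hc : Consistent G c) :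
    ∃ k x, AllAllocated G x ∧ Reach G c k x := by
  classical
  induction hN : (Finset.univ.filter fun i => ¬ ∃ t, Holds G c i t).card
    using Nat.strong_induction_on generalizing c with
  | _ N ih =>
    subst hN
    by_cases hall : ∀ i, ∃ t, Holds G c i t
    · exact ⟨0, c, ⟨hc.atRoundStart, fun i => (hall i).choose_spec.allocated hc⟩, .refl⟩
    · push Not at hall
      obtain ⟨i, hi⟩ := hall
      obtain ⟨x, t, hx, hxc, hxt⟩ := exists_reach_holds (G := G) hn hc.atRoundStart
        (hc.hasOption (hd i))
      have hlt : (Finset.univ.filter fun j => ¬ ∃ t, Holds G x j t) ⊂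
          Finset.univ.filter fun j => ¬ ∃ t, Holds G c j t := by
        refine (Finset.ssubset_iff_of_subset fun j hj => ?_).2 ⟨i, ?_, ?_⟩
        · simp only [Finset.mem_filter, Finset.mem_univ, true_and] at hj ⊢
          rintro ⟨u, hu⟩
          exact hj ⟨u, hu.reach (by lia) hc hx⟩
        · simpa using hi
        · simpa using ⟨t, hxt⟩
      obtain ⟨k, y, hy, hxy⟩ := ih _ (Finset.card_lt_card hlt) hxc rfl
      exact ⟨_, y, hy, hx.trans hxy⟩

theorem Reach.of_next_roundStart {c x : Config V T n}
    (h : Reach G c (roundLength T n - c.pos) x) : AtRoundStart x := by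
  have := c.pos_lt
  rw [atRoundStart_iff_pos, h.pos, Nat.add_sub_cancel' this.le, Nat.mod_self]

theorem exists_reach_allAllocated (hn : 2 ≤ n) (hd : ∀ i, G.degree i < T)
    (c : Config V T n) : ∃ k x, AllAllocated G x ∧ Reach G c k x := by
  obtain ⟨x, hx⟩ := exists_reach (G := G) c (roundLength T n - c.pos)
  have hx0 := hx.of_next_roundStart
  obtain ⟨y, hy⟩ := exists_reach (G := G) x (1 * roundLength T n)
  have hN := c.pos_lt
  obtain ⟨k, z, hz, hyz⟩ := (hy.consistent (by lia) hx0 (by lia)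
    (hy.atRoundStart hx0)).exists_reach_allAllocated hn hd
  exact ⟨_, z, hz, (hx.trans hy).trans hyz⟩

variable (G) in
/-- A node with an option becomes allocated with probability bounded away from zero. -/
theorem exists_le_law_allocated (hn : 2 ≤ n) :
    ∃ p : ℝ≥0∞, 0 < p ∧ ∀ (c : Config V T n) (i : V), AtRoundStart c → HasOption c i →
      p ≤ law G c {R | Allocated G (R (roundLength T n)) i} := by
  classical
  have := Fintype.ofFinite (Config V T n)
  -- The bound is a minimum over finitely many pairs; the value 1 at irrelevant pairs keeps it
  -- positive.
  let f : Config V T n × V → ℝ≥0∞ := fun q =>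
    if AtRoundStart q.1 ∧ HasOption q.1 q.2 then
      law G q.1 {R | Allocated G (R (roundLength T n)) q.2} else 1
  refine ⟨Finset.univ.inf f, (Finset.lt_inf_iff (by simp)).2 fun q _ => ?_, fun c i h0 h => ?_⟩
  · simp only [f]
    split_ifs with h
    · obtain ⟨x, t, hx, hxc, hxt⟩ := exists_reach_holds (G := G) hn h.1 h.2
      refine (law_pos_of_reach G hx).trans_le (measure_mono fun R hR => ?_)
      have hR : R (roundLength T n) = x := hR
      change Allocated G (R (roundLength T n)) q.2
      rw [hR]
      exact hxt.allocated hxc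
    · exact one_pos
  · refine (Finset.inf_le (Finset.mem_univ (c, i))).trans_eq ?_
    simp only [f]
    rw [if_pos ⟨h0, h⟩]

end Paths

end TDMA

/-! ### Convergence and closure -/

theorem mainTheorem1 (V : Type) [Fintype V] [DecidableEq V]
    (G : SimpleGraph V) [DecidableRel G.Adj]
    (T n : ℕ) (hT : 2 ≤ T) (hn : 2 ≤ n) (hd : ∀ i, G.degree i < T) :
    -- within two broadcasting rounds, and at the start of every later round, all nodes are in
    -- one of the three relative states
    (∀ R : ℕ → TDMA.Config V T n, TDMA.IsExecution G R →
      ∃ m ≤ 2 * TDMA.roundLength T n, ∀ y : ℕ,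
        TDMA.AtRoundStart (R (m + y * TDMA.roundLength T n)) ∧
        ∀ i, TDMA.Ready G (R (m + y * TDMA.roundLength T n)) i ∨
          TDMA.Obtaining G (R (m + y * TDMA.roundLength T n)) i ∨
          TDMA.Allocated G (R (m + y * TDMA.roundLength T n)) i) ∧
    -- in each round, such a node becomes allocated with a probability bounded away from zero
    (∃ p : ENNReal, 0 < p ∧ ∀ (c : TDMA.Config V T n) (i : V), TDMA.AtRoundStart c →
      (TDMA.Ready G c i ∨ TDMA.Obtaining G c i) →
      p ≤ TDMA.law G c {R | TDMA.Allocated G (R (TDMA.roundLength T n)) i}) ∧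
    -- convergence to a safe configuration in which all nodes are allocated, almost surely and
    -- in bounded expected time
    (∀ c : TDMA.Config V T n, ∀ᵐ R ∂(TDMA.law G c),
      ∃ m, TDMA.AllAllocated G (R m) ∧ TDMA.Safe G (R m)) ∧
    (∃ B : NNReal, ∀ c : TDMA.Config V T n,
      ∫⁻ R, TDMA.convergenceTime G R ∂(TDMA.law G c) ≤ B) ∧
    -- closure: allocated nodes remain allocated, and the execution is legal
    (∀ R : ℕ → TDMA.Config V T n, TDMA.IsExecution G R → TDMA.AllAllocated G (R 0) →
      R ∈ TDMA.LE G ∧ ∀ y : ℕ, TDMA.AllAllocated G (R (y * TDMA.roundLength T n))) ∧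
    -- closure: from a safe configuration, every execution is legal
    (∀ R : ℕ → TDMA.Config V T n, TDMA.IsExecution G R → TDMA.AtPulse (R 0) →
      TDMA.Safe G (R 0) → R ∈ TDMA.LE G) := by

  have hn0 : 0 < n := by lia
  have hN : 0 < TDMA.roundLength T n := TDMA.roundLength_pos (by lia)
  obtain ⟨B, hB⟩ := TDMA.exists_lintegral_convergenceTime_le G
    (TDMA.exists_reach_allAllocated (G := G) (T := T) hn hd)
  refine ⟨fun R hR => ?_, ?_, fun c => ?_, ⟨B, hB⟩, fun R hR h0 => ⟨?_, fun y => ?_⟩,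
    fun R hR h0 hs => ?_⟩
  · have h1 := hR.reach 0 (TDMA.roundLength T n - (R 0).pos)
    rw [zero_add] at h1
    have h2 := h1.of_next_roundStart
    -- At most one round passes until a round start, and one full round from there makes the views
    -- correct.
    refine ⟨TDMA.roundLength T n - (R 0).pos + TDMA.roundLength T n, by lia, fun y => ?_⟩
    have h3 := hR.reach (TDMA.roundLength T n - (R 0).pos) ((y + 1) * TDMA.roundLength T n)
    rw [show TDMA.roundLength T n - (R 0).pos + (y + 1) * TDMA.roundLength T n =
      TDMA.roundLength T n - (R 0).pos + TDMA.roundLength T n + y * TDMA.roundLength T n by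
        ring] at h3
    have h4 := h3.atRoundStart h2
    exact ⟨h4, fun i => (h3.consistent hn0 h2 (by positivity) h4).ready_or_obtaining_or_allocated
      (hd i)⟩
  · obtain ⟨p, hp, h⟩ := TDMA.exists_le_law_allocated G (T := T) hn
    exact ⟨p, hp, fun c i h0 hi => h c i h0 (hi.elim (fun h => h.2.2.1) fun h => h.2.2.1)⟩
  · filter_upwards [TDMA.ae_exists_allAllocated G (hB c)] with R ⟨m, hm⟩
    exact ⟨m, hm, hm.safe hn0⟩
  · exact hR.mem_LE hn0 h0.1.1 fun i => (h0.2 i).exists_holds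
  -- The case `y = 0` is the hypothesis itself: `R 0` need not be `Consistent`, as `Allocated`
  -- leaves open a node's mark for its own slot.
  · rcases Nat.eq_zero_or_pos y with rfl | hy
    · simpa using h0
    · have h1 := hR.reach 0 (y * TDMA.roundLength T n)
      rw [zero_add] at h1
      have h2 := h1.atRoundStart h0.1
      have h3 := h1.consistent hn0 h0.1 (by positivity) h2
      refine ⟨h2, fun i => ?_⟩
      obtain ⟨t, ht⟩ := (hR.forall_holds hn0 h0.1.1 (fun i => (h0.2 i).exists_holds)
        (y * TDMA.roundLength T n)).2 i
      exact ht.allocated h3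
  -- Only the legality of the first configuration of `R'` is used; it already gives every node a
  -- slot in exclusive use.
  · obtain ⟨R', hR', he⟩ := hs
    have h1 := hR'.2 0
    rw [he] at h1
    exact hR.mem_LE hn0 h0 (h1.forall_holds hd)
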